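/- **Setting.** Let $f,g:\mathbb{R}^{d_x}\times\mathbb{R}^{d_y}\to\mathbb{R}$ be twice continuously differentiable, with $g(x,\cdot)$ $\mu$-strongly convex for every $x$ ($\mu>0$). Jointly in $(x,y)$ (Euclidean norm, operator norm for matrices), let $f$ be $L_{f,0}$-Lipschitz, $\nabla f$ be $L_{f,1}$-Lipschitz, $\nabla g$ be $L_{g,1}$-Lipschitz, and $\nabla_x\nabla_y g$, $\nabla_y\nabla_y g$ be $L_{g,2}$-Lipschitz. Put $y^*(x)=\arg\min_y g(x,y)$, $\Phi(x)=f(x,y^*(x))$, and assume $\Phi\ge m$ for some $m\in\mathbb{R}$. Let $$R(x,y,v)=\tfrac12 v^{T}\nabla_y\nabla_y g(x,y)v-v^{T}\nabla_y f(x,y),\qquad \bar\nabla f(x,y,v)=\nabla_x f(x,y)-\nabla_x\nabla_y g(x,y)\,v .$$ **Algorithm (D-TFBO).** Input $x_0,y_0,v_0$, numbers $\alpha_0,\beta_0,\gamma_0>0$, and $T\ge1$; put $\epsilon_y=\epsilon_v=1/T$. For $t=0,\dots,T-1$: 1. Start from $y_t^0=y_{t-1}^{P_{t-1}}$ and $v_t^0=v_{t-1}^{Q_{t-1}}$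 (from $y_0$, $v_0$ if $t=0$). 2. While $\|\nabla_y g(x_t,y_t^p)\|^2>\epsilon_y$, set $\beta_{p+1}^2=\beta_p^2+\|\nabla_y g(x_t,y_t^p)\|^2$ and $y_t^{p+1}=y_t^p-\frac1{\beta_{p+1}}\nabla_y g(x_t,y_t^p)$, starting at $p=0$ with the input $\beta_0$ for every $t$. Let $P_t$ be the number of iterations made. 3. While $\|\nabla_v R(x_t,y_t^{P_t},v_t^q)\|^2>\epsilon_v$, set $\gamma_{q+1}^2=\gamma_q^2+\|\nabla_v R(x_t,y_t^{P_t},v_t^q)\|^2$ and $v_t^{q+1}=v_t^q-\frac1{\gamma_{q+1}}\nabla_v R(x_t,y_t^{P_t},v_t^q)$, starting at $q=0$ with the input $\gamma_0$ for every $t$. Let $Q_t$ be the number of iterations made. 4. Set $\alpha_{t+1}^2=\alpha_t^2+\|\bar\nabla f(x_t,y_t^{P_t},v_t^{Q_t})\|^2$ and $x_{t+1}=x_t-\frac{1}{\alpha_{t+1}}\bar\nabla f(x_t,y_t^{P_t},v_t^{Q_t})$. A point $\bar x$ is an $\epsilon$-accurate stationary point if $\|\nabla\Phi(\bar x)\|^2\le\epsilon$.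 The gradient complexity $\mathrm{Gc}$ of a run is its total number of gradient evaluations: in outer iteration $t$, $P_t+1$ evaluations of $\nabla_y g$; $Q_t+1$ evaluations of $\nabla_v R$, each counted as two (one $\nabla_y f$, one Hessian-vector product); and one $\bar\nabla f$, counted as two (one $\nabla_x f$, one Jacobian-vector product). **Claim.** The function $\Phi$ is differentiable. There are a constant $C_0>0$, depending only on $\mu,L_{f,0},L_{f,1},L_{g,1},L_{g,2},\alpha_0$ and an upper bound on $\Phi(x_0)-m$, and a constant $C_1>0$, depending only on these, on $\beta_0,\gamma_0$, and on upper bounds on $\|y_0-y^*(x_0)\|$ and $\|v_0\|$ (so neither depends on the dimensions, on $\epsilon$ or on $T$), such that for every $\epsilon\in(0,1)$: * for every integer $T\ge C_0/\epsilon$, D-TFBO with $T$ outer iterations terminates (all sub-loops are finite), and $$\frac1T\sum_{t=0}^{T-1}\|\nabla\Phi(x_t)\|^2\le\epsilon ;$$ in particular, some $x_t$ with $t<T$ is an $\epsilon$-accurate stationary point; * for the least such $T$, namely $T=\lceil C_0/\epsilon\rceil$, one has $T\le C_1/\epsilon$, $P_t\le C_1/\epsilon$ and $Q_t\le C_1/\epsilon$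 for all $t<T$, and $\mathrm{Gc}\le C_1/\epsilon^2$. That is, $T=\mathcal{O}(1/\epsilon)$ outer iterations, $P_t,Q_t=\mathcal{O}(1/\epsilon)$ sub-loop iterations, and gradient complexity $\mathcal{O}(1/\epsilon^2)$ suffice. -/

import Mathlib

open scoped NNReal Gradient

noncomputable section

namespace Bilevel

/-- The Euclidean space `ℝ^d`. -/
abbrev Vec (d : ℕ) : Type := EuclideanSpace ℝ (Fin d)

/-- The joint space `ℝ^dx × ℝ^dy` with its Euclidean norm. -/
abbrev Joint (dx dy : ℕ) : Type := WithLp 2 (Vec dx × Vec dy)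

variable {dx dy : ℕ}

/-- The point `(x, y)` of the joint space. -/
abbrev pt (x : Vec dx) (y : Vec dy) : Joint dx dy := WithLp.toLp 2 (x, y)

/-- The partial gradient `∇_x h (x, y)`. -/
def gradX (h : Joint dx dy → ℝ) (x : Vec dx) (y : Vec dy) : Vec dx :=
  ∇ (fun x' => h (pt x' y)) x

/-- The partial gradient `∇_y h (x, y)`. -/
def gradY (h : Joint dx dy → ℝ) (x : Vec dx) (y : Vec dy) : Vec dy :=
  ∇ (fun y' => h (pt x y')) y

/-- The Hessian block `∇_y ∇_y g (x, y)`, as a linear map `ℝ^dy → ℝ^dy`. -/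
def hessYY (g : Joint dx dy → ℝ) (x : Vec dx) (y : Vec dy) : Vec dy →L[ℝ] Vec dy :=
  fderiv ℝ (fun y' => gradY g x y') y

/-- The mixed block `∇_x ∇_y g (x, y)`: the `dx × dy` matrix with entries
`∂/∂x_i (∂g/∂y_j)`, as a linear map `ℝ^dy → ℝ^dx`. It is the transpose of the
Jacobian in `x` of `∇_y g`. -/
def hessXY (g : Joint dx dy → ℝ) (x : Vec dx) (y : Vec dy) : Vec dy →L[ℝ] Vec dx :=
  ContinuousLinearMap.adjoint (fderiv ℝ (fun x' => gradY g x' y) x)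

/-- `y*(x)`, a minimizer of `g(x, ·)` over `ℝ^dy` (there is exactly one when `g(x, ·)`
is continuous and strongly convex). -/
def yStar (g : Joint dx dy → ℝ) (x : Vec dx) : Vec dy :=
  Classical.epsilon fun y => ∀ y' : Vec dy, g (pt x y) ≤ g (pt x y')

/-- The outer objective `Φ(x) = f(x, y*(x))`. -/
def Phi (f g : Joint dx dy → ℝ) (x : Vec dx) : ℝ := f (pt x (yStar g x))

/-- `R(x, y, v) = (1/2) vᵀ ∇_y∇_y g(x, y) v - vᵀ ∇_y f(x, y)`. -/
def linSys (f g : Joint dx dy → ℝ) (x : Vec dx) (y v : Vec dy) : ℝ :=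
  1 / 2 * inner ℝ v (hessYY g x y v) - inner ℝ v (gradY f x y)

/-- `∇_v R(x, y, v)`. -/
def gradLinSys (f g : Joint dx dy → ℝ) (x : Vec dx) (y v : Vec dy) : Vec dy :=
  ∇ (fun v' => linSys f g x y v') v

/-- The hypergradient estimate `∇_x f(x, y) - ∇_x∇_y g(x, y) v`. -/
def hyperGrad (f g : Joint dx dy → ℝ) (x : Vec dx) (y v : Vec dy) : Vec dx :=
  gradX f x y - hessXY g x y v

/-- Regularity of the bilevel problem: `f`, `g` are twice continuously differentiable, `g` is
`μ`-strongly convex in `y`, `f` is `Lf0`-Lipschitz, `∇f` is `Lf1`-Lipschitz, `∇g` is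
`Lg1`-Lipschitz, and `∇_x∇_y g`, `∇_y∇_y g` are `Lg2`-Lipschitz, all jointly in `(x, y)`. -/
structure Regular (f g : Joint dx dy → ℝ) (μ : ℝ) (Lf0 Lf1 Lg1 Lg2 : ℝ≥0) : Prop where
  contDiff_f : ContDiff ℝ 2 f
  contDiff_g : ContDiff ℝ 2 g
  strongConvex : ∀ x : Vec dx, StrongConvexOn Set.univ μ (fun y : Vec dy => g (pt x y))
  lip_f : LipschitzWith Lf0 f
  lip_grad_f : LipschitzWith Lf1 (∇ f)
  lip_grad_g : LipschitzWith Lg1 (∇ g)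
  lip_hessXY : LipschitzWith Lg2 (fun z : Joint dx dy => hessXY g z.fst z.snd)
  lip_hessYY : LipschitzWith Lg2 (fun z : Joint dx dy => hessYY g z.fst z.snd)

/-- `xbar` is an `ε`-accurate stationary point of `F`. -/
def IsAccurate (F : Vec dx → ℝ) (ε : ℝ) (xbar : Vec dx) : Prop :=
  DifferentiableAt ℝ F xbar ∧ ‖∇ F xbar‖ ^ 2 ≤ ε

/-- The pair `(u^p, b_p)` of the "inverse of cumulative gradient norm" iteration driven by `G`:
`b_{p+1}^2 = b_p^2 + ‖G(u^p)‖^2` and `u^{p+1} = u^p - (1 / b_{p+1}) G(u^p)`. -/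
def adaIter {d : ℕ} (G : Vec d → Vec d) (b0 : ℝ) (u0 : Vec d) : ℕ → Vec d × ℝ
  | 0 => (u0, b0)
  | p + 1 =>
    let u := (adaIter G b0 u0 p).1
    let b := √((adaIter G b0 u0 p).2 ^ 2 + ‖G u‖ ^ 2)
    (u - (1 / b) • G u, b)

/-- The loop "while `‖G(u^p)‖^2 > e`, iterate" exits after exactly `N` iterations. -/
def ExitsAt {d : ℕ} (G : Vec d → Vec d) (b0 : ℝ) (u0 : Vec d) (e : ℝ) (N : ℕ) : Prop :=
  ‖G (adaIter G b0 u0 N).1‖ ^ 2 ≤ e ∧ ∀ p < N, e < ‖G (adaIter G b0 u0 p).1‖ ^ 2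

/-- A complete (terminating) execution of D-TFBO with `T` outer iterations and sub-loop tolerances
`ε_y = ε_v = 1 / T`. Here `y t` and `v t` are the warm-start values `y_t^0` and `v_t^0`, so that
`y (t + 1) = y_t^{P_t}` and `v (t + 1) = v_t^{Q_t}`; the accumulators of both
sub-loops restart from `β0`, `γ0` in every outer iteration. -/
structure DTFBO (f g : Joint dx dy → ℝ) (x0 : Vec dx) (y0 v0 : Vec dy) (α0 β0 γ0 : ℝ)
    (T : ℕ) where
  x : ℕ → Vec dx
  y : ℕ → Vec dy
  v : ℕ → Vec dy
  α : ℕ → ℝ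
  /-- number of iterations of the sub-loop for `y` -/
  P : ℕ → ℕ
  /-- number of iterations of the sub-loop for `v` -/
  Q : ℕ → ℕ
  x_zero : x 0 = x0
  y_zero : y 0 = y0
  v_zero : v 0 = v0
  α_zero : α 0 = α0
  y_exit : ∀ t < T, ExitsAt (gradY g (x t)) β0 (y t) (1 / (T : ℝ)) (P t)
  y_succ : ∀ t < T, y (t + 1) = (adaIter (gradY g (x t)) β0 (y t) (P t)).1
  v_exit : ∀ t < T, ExitsAt (gradLinSys f g (x t) (y (t + 1))) γ0 (v t) (1 / (T : ℝ)) (Q t)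
  v_succ : ∀ t < T,
    v (t + 1) = (adaIter (gradLinSys f g (x t) (y (t + 1))) γ0 (v t) (Q t)).1
  α_succ : ∀ t < T,
    α (t + 1) = √(α t ^ 2 + ‖hyperGrad f g (x t) (y (t + 1)) (v (t + 1))‖ ^ 2)
  x_succ : ∀ t < T,
    x (t + 1) = x t - (1 / α (t + 1)) • hyperGrad f g (x t) (y (t + 1)) (v (t + 1))

/-- The number of gradient evaluations of an execution. In outer iteration `t` the vector `∇_y g` is
evaluated at `y_t^0, …, y_t^{P_t}`; `∇_v R` is evaluated at `v_t^0, …, v_t^{Q_t}`, each time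
with one evaluation of `∇_y f` and one Hessian-vector product; and the hypergradient
estimate takes one evaluation of `∇_x f` and one Jacobian-vector product. -/
def DTFBO.gradientCount {f g : Joint dx dy → ℝ} {x0 : Vec dx} {y0 v0 : Vec dy} {α0 β0 γ0 : ℝ}
    {T : ℕ} (r : DTFBO f g x0 y0 v0 α0 β0 γ0 T) : ℕ :=
  ∑ t ∈ Finset.range T, ((r.P t + 1) + 2 * (r.Q t + 1) + 2)

end Bilevel

end

/-!
Everything rests on one estimate for gradient descent with steps `1 / a_{t+1}`, where
`a_{t+1}^2 = a_t^2 + ‖h_t‖^2`, along inexact gradients `h_t` of an `L`-smooth function `φ ≥ m`. By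
the descent lemma, the potential
`φ(x_t) + a_t / 4 - L / (2 a_0^2) * min(a_t, 2 L)^2`
drops in each step by at least `‖∇φ(x_t)‖^2 / (2 a_{t+1})`, up to the error
`‖h_t - ∇φ(x_t)‖^2 / (2 a_0)` (`potential_step`): the curvature term `L ‖h_t‖^2 / (2 a_{t+1}^2)` is
absorbed by the descent if `a_{t+1} ≥ 2 L`, and by the growth of `min(a_t, 2 L)^2` otherwise. As the
potential is bounded below by a multiple of `a_t` minus a constant, both `a_T` and
`∑ ‖∇φ(x_t)‖^2` are bounded independently of `T` as soon as the squared errors are summable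
(`acc_le_and_sum_sq_le`).

In a sub-loop the gradients are exact and each iteration made adds more than `1 / T` to the bounded
sum of squared gradients, so that there are `O(T)` iterations (`length_mul_le`). The bound depends
on the distance of the warm start from the minimizer, which is controlled because the previous
sub-loop ended near its own minimizer and an outer step has length at most `1`.

For the outer loop, `Φ` is differentiable with gradient the hypergradient at `y*(x)` and `v*(x)`
(`Regular.hasGradientAt_Phi`). Strong convexity turns the tolerances `1 / T` of the sub-loops into
a squared error `O(1 / T)` of the hypergradient estimate, hence a bounded sum of `T` errors; the
same sensitivity estimate (`Regular.norm_hyperGrad_sub_vStar_le`) shows that `∇Φ` is Lipschitz. So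
`∑ ‖∇Φ(x_t)‖^2` is at most a constant `C₀`, and its average over `T ≥ C₀ / ε` terms is at most `ε`.
-/

open scoped NNReal Gradient

noncomputable section

namespace Bilevel

/-! ### Smooth and strongly convex functions -/

theorem mul_norm_le_of_inner {E : Type*} [NormedAddCommGroup E] [InnerProductSpace ℝ E]
    {μ : ℝ} {a w : E} (h : μ * ‖w‖ ^ 2 ≤ inner ℝ a w) :
    μ * ‖w‖ ≤ ‖a‖ := by
  rcases (norm_nonneg w).eq_or_lt with h0 | h0
  · rw [← h0, mul_zero]; exact norm_nonneg a
  · refine le_of_mul_le_mul_right ?_ h0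
    nlinarith [real_inner_le_norm a w]

section Hilbert

variable {E : Type*} [NormedAddCommGroup E] [InnerProductSpace ℝ E] [CompleteSpace E]

theorem hasDerivAt_comp_line {φ : E → ℝ} {G : E → E} (hG : ∀ u, HasGradientAt φ (G u) u)
    (u w : E) (t : ℝ) :
    HasDerivAt (fun t : ℝ => φ (u + t • w)) (inner ℝ (G (u + t • w)) w) t := by
  have h1 : HasDerivAt (fun t : ℝ => u + t • w) w t := by
    simpa using ((hasDerivAt_id t).smul_const w).const_add u
  exact ((hG (u + t • w)).hasFDerivAt.comp_hasDerivAt t h1).congr_deriv (by simp)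

/-- The descent lemma: a function with `L`-Lipschitz gradient lies below its quadratic model. -/
theorem le_quadratic_model {φ : E → ℝ} {G : E → E} {L : ℝ}
    (hG : ∀ u, HasGradientAt φ (G u) u) (hL : ∀ u u', ‖G u - G u'‖ ≤ L * ‖u - u'‖) (u w : E) :
    φ (u + w) ≤ φ u + inner ℝ (G u) w + L / 2 * ‖w‖ ^ 2 := by
  have hd : ∀ t : ℝ, HasDerivAt
      (fun t : ℝ => φ (u + t • w) - t * inner ℝ (G u) w - L / 2 * ‖w‖ ^ 2 * t ^ 2)
      (inner ℝ (G (u + t • w)) w - inner ℝ (G u) w - L * ‖w‖ ^ 2 * t) t := by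
    intro t
    refine (((hasDerivAt_comp_line hG u w t).sub
      ((hasDerivAt_id t).mul_const (inner ℝ (G u) w))).sub
      ((hasDerivAt_pow 2 t).const_mul (L / 2 * ‖w‖ ^ 2))).congr_deriv ?_
    norm_num
    ring
  have hanti := antitoneOn_of_deriv_nonpos (convex_Icc (0 : ℝ) 1)
    (fun t _ => (hd t).continuousAt.continuousWithinAt)
    (fun t _ => (hd t).differentiableAt.differentiableWithinAt) (by
      intro t ht
      rw [interior_Icc] at ht
      rw [(hd t).deriv, ← inner_sub_left]
      have h1 := real_inner_le_norm (G (u + t • w) - G u) w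
      have h2 := hL (u + t • w) u
      rw [add_sub_cancel_left, norm_smul, Real.norm_eq_abs, abs_of_pos ht.1] at h2
      nlinarith [mul_le_mul_of_nonneg_right h2 (norm_nonneg w)])
  have := hanti (Set.left_mem_Icc.2 zero_le_one) (Set.right_mem_Icc.2 zero_le_one) zero_le_one
  norm_num at this
  linarith

/-- The first-order characterization of strong convexity, as the limit `t → 0` of the convexity
inequality on the segment from `u` to `u + w`. -/
theorem quadratic_model_le {φ : E → ℝ} {G : E → E} {μ : ℝ}
    (hG : ∀ u, HasGradientAt φ (G u) u) (hc : StrongConvexOn Set.univ μ φ) (u w : E) :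
    φ u + inner ℝ (G u) w + μ / 2 * ‖w‖ ^ 2 ≤ φ (u + w) := by
  have h0 := hasDerivAt_comp_line hG u w 0
  rw [zero_smul, add_zero] at h0
  have h1 := h0.tendsto_slope_zero_right
  have h2 : Filter.Tendsto (fun t : ℝ => φ (u + w) - φ u - (1 - t) * (μ / 2 * ‖w‖ ^ 2))
      (nhdsWithin 0 (Set.Ioi 0)) (nhds (φ (u + w) - φ u - (1 - 0) * (μ / 2 * ‖w‖ ^ 2))) :=
    Continuous.tendsto' (by fun_prop) _ _ rfl |>.mono_left nhdsWithin_le_nhds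
  have h3 : inner ℝ (G u) w ≤ φ (u + w) - φ u - (1 - 0) * (μ / 2 * ‖w‖ ^ 2) := by
    refine le_of_tendsto_of_tendsto h1 h2 ?_
    have : Set.Ioo (0 : ℝ) 1 ∈ nhdsWithin (0 : ℝ) (Set.Ioi 0) := Ioo_mem_nhdsGT one_pos
    filter_upwards [this] with t ht
    have h4 := hc.2 (Set.mem_univ u) (Set.mem_univ (u + w)) (sub_nonneg.2 ht.2.le) ht.1.le
      (by ring)
    have h5 : (1 - t) • u + t • (u + w) = u + t • w := by module
    rw [h5] at h4
    simp only [sub_add_cancel_left, norm_neg, smul_eq_mul] at h4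
    simp only [zero_add, zero_smul, add_zero, smul_eq_mul]
    rw [inv_mul_le_iff₀ ht.1]
    linarith
  linarith

/-- The gradient of a strongly convex function is strongly monotone. -/
theorem strong_monotone {φ : E → ℝ} {G : E → E} {μ : ℝ}
    (hG : ∀ u, HasGradientAt φ (G u) u) (hc : StrongConvexOn Set.univ μ φ) (u w : E) :
    μ * ‖w‖ ^ 2 ≤ inner ℝ (G (u + w) - G u) w := by
  have h1 := quadratic_model_le hG hc u w
  have h2 := quadratic_model_le hG hc (u + w) (-w)
  rw [add_neg_cancel_right, inner_neg_right, norm_neg] at h2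
  rw [inner_sub_left]
  linarith

theorem exists_minimizer [FiniteDimensional ℝ E] {φ : E → ℝ} {G : E → E} {μ : ℝ} (hμ : 0 < μ)
    (hG : ∀ u, HasGradientAt φ (G u) u) (hc : StrongConvexOn Set.univ μ φ) :
    ∃ u, ∀ u', φ u ≤ φ u' := by
  have hcont : Continuous φ := continuous_iff_continuousAt.2 fun u => (hG u).continuousAt
  refine hcont.exists_forall_le ?_
  have h1 : Filter.Tendsto (fun u : E => φ 0 + ‖u‖ * (μ / 2 * ‖u‖ - ‖G 0‖))
      (Filter.cocompact E) Filter.atTop := by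
    have hn := tendsto_norm_cocompact_atTop (E := E)
    refine Filter.tendsto_atTop_add_const_left _ _ (hn.atTop_mul_atTop₀ ?_)
    exact Filter.tendsto_atTop_add_const_right _ _ (hn.const_mul_atTop (by positivity))
  refine Filter.tendsto_atTop_mono (fun u => ?_) h1
  have h2 := quadratic_model_le hG hc 0 u
  rw [zero_add] at h2
  have h3 := neg_le_of_abs_le (abs_real_inner_le_norm (G 0) u)
  nlinarith

theorem gradient_eq_zero_of_forall_le {φ : E → ℝ} {a u : E} (h : HasGradientAt φ a u)
    (hmin : ∀ u', φ u ≤ φ u') : a = 0 := by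
  have h1 : IsLocalMin φ u := Filter.Eventually.of_forall hmin
  simpa using h1.hasFDerivAt_eq_zero h.hasFDerivAt

/-! ### Gradient descent with inverse cumulative gradient norm steps -/

/-- The bound on the accumulator, and through it on the squared gradients, of a run started with
accumulator `a0` and optimality gap at most `D`, for an `L`-smooth function and directions whose
squared errors sum to at most `S`. -/
def accBound (L a0 D S : ℝ) : ℝ := a0 + 4 * (D + S / (2 * a0) + 2 * L ^ 3 / a0 ^ 2)

theorem accBound_pos {L a0 D S : ℝ} (hL : 0 ≤ L) (ha : 0 < a0) (hD : 0 ≤ D) (hS : 0 ≤ S) :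
    0 < accBound L a0 D S := by
  unfold accBound
  positivity

/-- The one-step inequality. Once `a' ≥ 2 L` the curvature term of the descent lemma is absorbed by
the descent; before that, it is paid for by the growth of `min a (2 L) ^ 2`. -/
theorem potential_step {φ : E → ℝ} {G : E → E} {L : ℝ} (hL0 : 0 ≤ L)
    (hG : ∀ u, HasGradientAt φ (G u) u) (hL : ∀ u u', ‖G u - G u'‖ ≤ L * ‖u - u'‖)
    {a0 a a' : ℝ} {x h : E} (ha0 : 0 < a0) (ha : a0 ≤ a) (ha' : a' = √(a ^ 2 + ‖h‖ ^ 2)) :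
    a ≤ a' ∧ φ (x - (1 / a') • h) + ‖G x‖ ^ 2 / (2 * a') + a' / 4
        - L / (2 * a0 ^ 2) * min a' (2 * L) ^ 2
      ≤ φ x + a / 4 - L / (2 * a0 ^ 2) * min a (2 * L) ^ 2 + ‖h - G x‖ ^ 2 / (2 * a0) := by
  have hapos : 0 < a := ha0.trans_le ha
  have hsq : a' ^ 2 = a ^ 2 + ‖h‖ ^ 2 := by rw [ha', Real.sq_sqrt (by positivity)]
  have ha'0 : 0 ≤ a' := ha' ▸ Real.sqrt_nonneg _
  have haa' : a ≤ a' := abs_le_of_sq_le_sq' (by nlinarith [sq_nonneg ‖h‖]) ha'0 |>.2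
  refine ⟨haa', ?_⟩
  have ha'pos : 0 < a' := hapos.trans_le haa'
  have hdesc := le_quadratic_model hG hL x (-((1 / a') • h))
  rw [← sub_eq_add_neg, inner_neg_right, inner_smul_right, norm_neg, norm_smul, Real.norm_eq_abs,
    abs_of_pos (by positivity)] at hdesc
  have hpol : ‖h - G x‖ ^ 2 = ‖h‖ ^ 2 - 2 * inner ℝ (G x) h + ‖G x‖ ^ 2 := by
    rw [norm_sub_sq_real, real_inner_comm]
  have herr : ‖h - G x‖ ^ 2 / (2 * a') ≤ ‖h - G x‖ ^ 2 / (2 * a0) := by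
    gcongr
    exact ha.trans haa'
  have hinc : (a' - a) ≤ ‖h‖ ^ 2 / a' := by
    rw [le_div_iff₀ ha'pos]
    nlinarith
  have hcurv : L / 2 * (1 / a' * ‖h‖) ^ 2 ≤ ‖h‖ ^ 2 / a' / 4
      + (L / (2 * a0 ^ 2) * min a' (2 * L) ^ 2 - L / (2 * a0 ^ 2) * min a (2 * L) ^ 2) := by
    have e1 : L / 2 * (1 / a' * ‖h‖) ^ 2 = L / (2 * a' ^ 2) * ‖h‖ ^ 2 := by
      field_simp
    rw [e1]
    rcases le_total a' (2 * L) with hc | hc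
    · rw [min_eq_left hc, min_eq_left (haa'.trans hc)]
      have e2 : L / (2 * a' ^ 2) * ‖h‖ ^ 2 ≤ L / (2 * a0 ^ 2) * ‖h‖ ^ 2 := by
        gcongr
        exact ha.trans haa'
      have e3 : 0 ≤ ‖h‖ ^ 2 / a' / 4 := by positivity
      have e4 : L / (2 * a0 ^ 2) * a' ^ 2 - L / (2 * a0 ^ 2) * a ^ 2
          = L / (2 * a0 ^ 2) * ‖h‖ ^ 2 := by rw [hsq]; ring
      linarith
    · have e2 : L / (2 * a' ^ 2) * ‖h‖ ^ 2 ≤ ‖h‖ ^ 2 / a' / 4 := by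
        rw [div_mul_eq_mul_div, div_div, div_le_div_iff₀ (by positivity) (by positivity)]
        nlinarith [mul_nonneg (mul_nonneg (sq_nonneg ‖h‖) ha'0) (sub_nonneg.2 hc)]
      have e3 : L / (2 * a0 ^ 2) * min a (2 * L) ^ 2 ≤ L / (2 * a0 ^ 2) * min a' (2 * L) ^ 2 := by
        gcongr
      linarith
  have e5 : ‖h - G x‖ ^ 2 / (2 * a') = ‖h‖ ^ 2 / a' / 2 - 1 / a' * inner ℝ (G x) h
      + ‖G x‖ ^ 2 / (2 * a') := by
    rw [hpol]; field_simp
  linarith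

/-- A run of `T` steps keeps the accumulator, and the sum of the squared gradients, bounded
independently of `T`. -/
theorem acc_le_and_sum_sq_le {φ : E → ℝ} {G : E → E} {L : ℝ} (hL0 : 0 ≤ L)
    (hG : ∀ u, HasGradientAt φ (G u) u) (hL : ∀ u u', ‖G u - G u'‖ ≤ L * ‖u - u'‖)
    {m D S : ℝ} (hm : ∀ u, m ≤ φ u) {x h : ℕ → E} {a : ℕ → ℝ} (ha0 : 0 < a 0) {T : ℕ}
    (ha : ∀ t < T, a (t + 1) = √(a t ^ 2 + ‖h t‖ ^ 2))
    (hx : ∀ t < T, x (t + 1) = x t - (1 / a (t + 1)) • h t)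
    (hD : φ (x 0) - m ≤ D) (hS : ∑ t ∈ Finset.range T, ‖h t - G (x t)‖ ^ 2 ≤ S) :
    a T ≤ accBound L (a 0) D S ∧
      ∑ t ∈ Finset.range T, ‖G (x t)‖ ^ 2 ≤ accBound L (a 0) D S ^ 2 / 2 := by
  have key : ∀ n ≤ T, a 0 ≤ a n ∧ (∀ t < n, a (t + 1) ≤ a n) ∧
      φ (x n) + ∑ t ∈ Finset.range n, ‖G (x t)‖ ^ 2 / (2 * a (t + 1)) + a n / 4
        - L / (2 * a 0 ^ 2) * min (a n) (2 * L) ^ 2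
      ≤ φ (x 0) + a 0 / 4 - L / (2 * a 0 ^ 2) * min (a 0) (2 * L) ^ 2
        + (∑ t ∈ Finset.range n, ‖h t - G (x t)‖ ^ 2) / (2 * a 0) := by
    intro n
    induction n with
    | zero => intro _; simp
    | succ n ih =>
      intro hn
      obtain ⟨h1, h2, h3⟩ := ih (by omega)
      obtain ⟨h4, h5⟩ := potential_step hL0 hG hL (x := x n) ha0 h1 (ha n hn)
      rw [← hx n hn] at h5
      refine ⟨h1.trans h4, fun t ht => ?_, ?_⟩
      · rcases Nat.lt_succ_iff_lt_or_eq.1 ht with ht | rfl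
        · exact (h2 t ht).trans h4
        · exact le_rfl
      · rw [Finset.sum_range_succ, Finset.sum_range_succ, add_div]
        linarith
  obtain ⟨h1, h2, h3⟩ := key T le_rfl
  have haT : 0 < a T := ha0.trans_le h1
  have hmin : L / (2 * a 0 ^ 2) * min (a T) (2 * L) ^ 2 ≤ 2 * L ^ 3 / a 0 ^ 2 := by
    have e1 : min (a T) (2 * L) ^ 2 ≤ (2 * L) ^ 2 := by
      gcongr
      exact min_le_right _ _
    calc _ ≤ L / (2 * a 0 ^ 2) * (2 * L) ^ 2 := by gcongr
      _ = _ := by field_simp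
  have hmin0 : 0 ≤ L / (2 * a 0 ^ 2) * min (a 0) (2 * L) ^ 2 := by positivity
  have hS' : (∑ t ∈ Finset.range T, ‖h t - G (x t)‖ ^ 2) / (2 * a 0) ≤ S / (2 * a 0) := by
    gcongr
  have hmT := hm (x T)
  have hsum : (∑ t ∈ Finset.range T, ‖G (x t)‖ ^ 2) / (2 * a T)
      ≤ ∑ t ∈ Finset.range T, ‖G (x t)‖ ^ 2 / (2 * a (t + 1)) := by
    rw [Finset.sum_div]
    refine Finset.sum_le_sum fun t ht => ?_
    rw [Finset.mem_range] at ht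
    have e1 : 0 < a (t + 1) := ha0.trans_le (key (t + 1) ht).1
    have e2 := h2 t ht
    gcongr
  have hnn : 0 ≤ ∑ t ∈ Finset.range T, ‖G (x t)‖ ^ 2 := by positivity
  have hnn' : 0 ≤ (∑ t ∈ Finset.range T, ‖G (x t)‖ ^ 2) / (2 * a T) := by positivity
  have hB : a T ≤ accBound L (a 0) D S := by
    unfold accBound
    linarith
  refine ⟨hB, ?_⟩
  have h6 : (∑ t ∈ Finset.range T, ‖G (x t)‖ ^ 2) / (2 * a T) ≤ accBound L (a 0) D S / 4 := by
    unfold accBound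
    linarith
  rw [div_le_iff₀ (by positivity)] at h6
  nlinarith

end Hilbert

/-! ### Length of the sub-loops -/

/-- The accumulated squared gradients are bounded, and each of the `N` iterations made adds more
than `e` to them. -/
theorem length_mul_le {d : ℕ} {φ : Vec d → ℝ} {G : Vec d → Vec d} {L : ℝ} (hL0 : 0 ≤ L)
    (hG : ∀ u, HasGradientAt φ (G u) u) (hL : ∀ u u', ‖G u - G u'‖ ≤ L * ‖u - u'‖)
    {us : Vec d} (hus : ∀ u, φ us ≤ φ u) {b0 : ℝ} (hb0 : 0 < b0) {u0 : Vec d} {D : ℝ}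
    (hD : ‖u0 - us‖ ≤ D) {e : ℝ} {N : ℕ} (hN : ∀ p < N, e < ‖G (adaIter G b0 u0 p).1‖ ^ 2) :
    N * e ≤ accBound L b0 (L / 2 * D ^ 2) 0 ^ 2 / 2 := by
  have hgap : φ u0 - φ us ≤ L / 2 * D ^ 2 := by
    have h1 := le_quadratic_model hG hL us (u0 - us)
    rw [gradient_eq_zero_of_forall_le (hG us) hus, inner_zero_left, add_sub_cancel] at h1
    have h2 : L / 2 * ‖u0 - us‖ ^ 2 ≤ L / 2 * D ^ 2 := by gcongr
    linarith
  have h1 := (acc_le_and_sum_sq_le hL0 hG hL hus (x := fun p => (adaIter G b0 u0 p).1)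
    (h := fun p => G (adaIter G b0 u0 p).1) (a := fun p => (adaIter G b0 u0 p).2) (T := N)
    (D := L / 2 * D ^ 2) (S := 0) hb0 (fun _ _ => rfl) (fun _ _ => rfl) hgap (by simp)).2
  refine le_trans ?_ h1
  have h2 := Finset.card_nsmul_le_sum (Finset.range N)
    (fun p => ‖G (adaIter G b0 u0 p).1‖ ^ 2) e (fun p hp => (hN p (Finset.mem_range.1 hp)).le)
  simpa using h2

theorem exists_exitsAt {d : ℕ} {φ : Vec d → ℝ} {G : Vec d → Vec d} {L : ℝ} (hL0 : 0 ≤ L)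
    (hG : ∀ u, HasGradientAt φ (G u) u) (hL : ∀ u u', ‖G u - G u'‖ ≤ L * ‖u - u'‖)
    {us : Vec d} (hus : ∀ u, φ us ≤ φ u) {b0 : ℝ} (hb0 : 0 < b0) (u0 : Vec d) {e : ℝ}
    (he : 0 < e) : ∃ N, ExitsAt G b0 u0 e N := by
  have hex : ∃ N, ‖G (adaIter G b0 u0 N).1‖ ^ 2 ≤ e := by
    by_contra! hcon
    obtain ⟨N, hN⟩ := exists_nat_gt (accBound L b0 (L / 2 * ‖u0 - us‖ ^ 2) 0 ^ 2 / 2 / e)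
    rw [div_lt_iff₀ he] at hN
    exact hN.not_ge (length_mul_le hL0 hG hL hus hb0 le_rfl fun p _ => hcon p)
  classical
  exact ⟨Nat.find hex, Nat.find_spec hex, fun p hp => not_le.1 (Nat.find_min hex hp)⟩

/-! ### Partial gradients and blocks of the Hessian -/

variable {dx dy : ℕ}

theorem hasFDerivAt_pt_right (x : Vec dx) (y : Vec dy) :
    HasFDerivAt (fun y' : Vec dy => pt x y')
      ((WithLp.prodContinuousLinearEquiv 2 ℝ (Vec dx) (Vec dy)).symm.toContinuousLinearMap ∘L
        ContinuousLinearMap.inr ℝ (Vec dx) (Vec dy)) y :=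
  (WithLp.prodContinuousLinearEquiv 2 ℝ (Vec dx) (Vec dy)).symm.hasFDerivAt.comp y
    (hasFDerivAt_prodMk_right x y)

theorem hasFDerivAt_pt_left (x : Vec dx) (y : Vec dy) :
    HasFDerivAt (fun x' : Vec dx => pt x' y)
      ((WithLp.prodContinuousLinearEquiv 2 ℝ (Vec dx) (Vec dy)).symm.toContinuousLinearMap ∘L
        ContinuousLinearMap.inl ℝ (Vec dx) (Vec dy)) x :=
  (WithLp.prodContinuousLinearEquiv 2 ℝ (Vec dx) (Vec dy)).symm.hasFDerivAt.comp x
    (hasFDerivAt_prodMk_left x y)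

theorem contDiff_pt_right {n : WithTop ℕ∞} (x : Vec dx) :
    ContDiff ℝ n (fun y' : Vec dy => pt x y') :=
  (WithLp.prodContinuousLinearEquiv 2 ℝ (Vec dx) (Vec dy)).symm.contDiff.comp
    (contDiff_const.prodMk contDiff_id)

theorem inner_joint (z w : Joint dx dy) :
    inner ℝ z w = inner ℝ z.fst w.fst + inner ℝ z.snd w.snd :=
  WithLp.prod_inner_apply z w

theorem hasGradientAt_right {h : Joint dx dy → ℝ} {x : Vec dx} {y : Vec dy}
    (hd : DifferentiableAt ℝ h (pt x y)) :
    HasGradientAt (fun y' => h (pt x y')) (∇ h (pt x y)).snd y := by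
  refine (hd.hasGradientAt.hasFDerivAt.comp y (hasFDerivAt_pt_right x y)).congr_fderiv ?_
  ext w
  change inner ℝ (∇ h (pt x y)) (pt 0 w) = inner ℝ (∇ h (pt x y)).snd w
  simp [-inner_gradient_left]

theorem hasGradientAt_left {h : Joint dx dy → ℝ} {x : Vec dx} {y : Vec dy}
    (hd : DifferentiableAt ℝ h (pt x y)) :
    HasGradientAt (fun x' => h (pt x' y)) (∇ h (pt x y)).fst x := by
  refine (hd.hasGradientAt.hasFDerivAt.comp x (hasFDerivAt_pt_left x y)).congr_fderiv ?_
  ext w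
  change inner ℝ (∇ h (pt x y)) (pt w 0) = inner ℝ (∇ h (pt x y)).fst w
  simp [-inner_gradient_left]

theorem gradY_eq {h : Joint dx dy → ℝ} (hd : Differentiable ℝ h) (x : Vec dx) (y : Vec dy) :
    gradY h x y = (∇ h (pt x y)).snd :=
  (hasGradientAt_right (hd (pt x y))).gradient

theorem gradX_eq {h : Joint dx dy → ℝ} (hd : Differentiable ℝ h) (x : Vec dx) (y : Vec dy) :
    gradX h x y = (∇ h (pt x y)).fst :=
  (hasGradientAt_left (hd (pt x y))).gradient

theorem norm_fst_le (z : Joint dx dy) : ‖z.fst‖ ≤ ‖z‖ := by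
  refine abs_le_of_sq_le_sq' ?_ (norm_nonneg z) |>.2
  rw [WithLp.prod_norm_sq_eq_of_L2]
  nlinarith [sq_nonneg ‖z.snd‖]

theorem norm_snd_le (z : Joint dx dy) : ‖z.snd‖ ≤ ‖z‖ := by
  refine abs_le_of_sq_le_sq' ?_ (norm_nonneg z) |>.2
  rw [WithLp.prod_norm_sq_eq_of_L2]
  nlinarith [sq_nonneg ‖z.fst‖]

theorem norm_pt_sub_le (x x' : Vec dx) (y y' : Vec dy) :
    ‖pt x y - pt x' y'‖ ≤ ‖x - x'‖ + ‖y - y'‖ := by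
  refine abs_le_of_sq_le_sq' ?_ (by positivity) |>.2
  have h : ‖pt x y - pt x' y'‖ ^ 2 = ‖x - x'‖ ^ 2 + ‖y - y'‖ ^ 2 := WithLp.prod_norm_sq_eq_of_L2 _
  nlinarith [mul_nonneg (norm_nonneg (x - x')) (norm_nonneg (y - y'))]

theorem norm_pt_sub_right (x : Vec dx) (y y' : Vec dy) : ‖pt x y - pt x y'‖ = ‖y - y'‖ := by
  rw [← sq_eq_sq₀ (norm_nonneg _) (norm_nonneg _), WithLp.prod_norm_sq_eq_of_L2]
  simp

theorem norm_pt_sub_left (x x' : Vec dx) (y : Vec dy) : ‖pt x y - pt x' y‖ = ‖x - x'‖ := by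
  rw [← sq_eq_sq₀ (norm_nonneg _) (norm_nonneg _), WithLp.prod_norm_sq_eq_of_L2]
  simp

theorem contDiff_gradient {E : Type*} [NormedAddCommGroup E] [InnerProductSpace ℝ E]
    [CompleteSpace E] {φ : E → ℝ} (hφ : ContDiff ℝ 2 φ) : ContDiff ℝ 1 (∇ φ) :=
  (InnerProductSpace.toDual ℝ E).symm.contDiff.comp (hφ.fderiv_right (m := 1) (by norm_num))

/-- The Hessian is symmetric. -/
theorem inner_fderiv_gradient_comm {E : Type*} [NormedAddCommGroup E] [InnerProductSpace ℝ E]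
    [CompleteSpace E] {φ : E → ℝ} (hφ : ContDiff ℝ 2 φ) (u a b : E) :
    inner ℝ (fderiv ℝ (∇ φ) u a) b = inner ℝ a (fderiv ℝ (∇ φ) u b) := by
  have hd : DifferentiableAt ℝ (fderiv ℝ φ) u :=
    (hφ.fderiv_right (m := 1) (by norm_num)).differentiable one_ne_zero u
  have h1 : fderiv ℝ (∇ φ) u =
      (InnerProductSpace.toDual ℝ E).symm.toContinuousLinearEquiv.toContinuousLinearMap ∘L
        fderiv ℝ (fderiv ℝ φ) u :=
    ((InnerProductSpace.toDual ℝ E).symm.toContinuousLinearEquiv.hasFDerivAt.comp u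
      hd.hasFDerivAt).fderiv
  have h2 : ∀ c d, inner ℝ (fderiv ℝ (∇ φ) u c) d = fderiv ℝ (fderiv ℝ φ) u c d := by
    intro c d
    rw [h1]
    exact InnerProductSpace.toDual_symm_apply
  rw [h2, real_inner_comm, h2]
  exact (hφ.contDiffAt.isSymmSndFDerivAt (by simp)).eq a b

theorem contDiff_gradY {g : Joint dx dy → ℝ} (hg : ContDiff ℝ 2 g) :
    ContDiff ℝ 1 (fun z : Joint dx dy => gradY g z.fst z.snd) := by
  have h1 : (fun z : Joint dx dy => gradY g z.fst z.snd) =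
      fun z => WithLp.sndL 2 ℝ (Vec dx) (Vec dy) (∇ g z) := by
    funext z
    exact gradY_eq (hg.differentiable two_ne_zero) _ _
  rw [h1]
  exact (WithLp.sndL 2 ℝ (Vec dx) (Vec dy)).contDiff.comp (contDiff_gradient hg)

theorem hessYY_apply {g : Joint dx dy → ℝ} (hg : ContDiff ℝ 2 g) (x : Vec dx) (y w : Vec dy) :
    hessYY g x y w = fderiv ℝ (fun z : Joint dx dy => gradY g z.fst z.snd) (pt x y) (pt 0 w) := by
  have h1 := ((contDiff_gradY hg).differentiable one_ne_zero (pt x y)).hasFDerivAt.comp y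
    (hasFDerivAt_pt_right x y)
  exact DFunLike.congr_fun h1.fderiv w

theorem adjoint_hessXY_apply {g : Joint dx dy → ℝ} (hg : ContDiff ℝ 2 g) (x w : Vec dx)
    (y : Vec dy) :
    ContinuousLinearMap.adjoint (hessXY g x y) w
      = fderiv ℝ (fun z : Joint dx dy => gradY g z.fst z.snd) (pt x y) (pt w 0) := by
  have h1 := ((contDiff_gradY hg).differentiable one_ne_zero (pt x y)).hasFDerivAt.comp x
    (hasFDerivAt_pt_left x y)
  rw [hessXY, ContinuousLinearMap.adjoint_adjoint]
  exact DFunLike.congr_fun h1.fderiv w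

theorem inner_hessYY_comm {g : Joint dx dy → ℝ} (hg : ContDiff ℝ 2 g) (x : Vec dx)
    (y a b : Vec dy) : inner ℝ (hessYY g x y a) b = inner ℝ a (hessYY g x y b) :=
  inner_fderiv_gradient_comm (hg.comp (contDiff_pt_right x)) y a b

/-- The linearization of `ψ(x, y) = f(x, y) - ⟪v, ∇_y g(x, y)⟫`, with `v` held fixed. -/
theorem hasGradientAt_lagrangian {f g : Joint dx dy → ℝ} (hf : ContDiff ℝ 2 f)
    (hg : ContDiff ℝ 2 g) (x : Vec dx) (y v : Vec dy) :
    HasGradientAt (fun z : Joint dx dy => f z - inner ℝ v (gradY g z.fst z.snd))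
      (pt (hyperGrad f g x y v) (gradY f x y - hessYY g x y v)) (pt x y) := by
  have hfd := hf.differentiable two_ne_zero
  have h1 := ((contDiff_gradY hg).differentiable one_ne_zero (pt x y)).hasFDerivAt
  have h2 := (hfd (pt x y)).hasGradientAt.hasFDerivAt.sub
    ((innerSL ℝ v).hasFDerivAt.comp (pt x y) h1)
  refine h2.congr_fderiv ?_
  ext w
  -- The derivative of `∇_y g` splits into its `x`-part, the adjoint of `∇_x∇_y g`, and `∇_y∇_y g`.
  have hw : w = pt w.fst 0 + pt 0 w.snd := by
    apply (WithLp.linearEquiv 2 ℝ _).injective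
    ext <;> simp
  have h3 : fderiv ℝ (fun z : Joint dx dy => gradY g z.fst z.snd) (pt x y) w
      = ContinuousLinearMap.adjoint (hessXY g x y) w.fst + hessYY g x y w.snd := by
    rw [adjoint_hessXY_apply hg, hessYY_apply hg, ← map_add, ← hw]
  change inner ℝ (∇ f (pt x y)) w - inner ℝ v
      (fderiv ℝ (fun z : Joint dx dy => gradY g z.fst z.snd) (pt x y) w)
    = inner ℝ (pt (hyperGrad f g x y v) (gradY f x y - hessYY g x y v)) w
  rw [h3, inner_joint, inner_joint, ← gradX_eq hfd, ← gradY_eq hfd, inner_add_right,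
    ContinuousLinearMap.adjoint_inner_right, ← inner_hessYY_comm hg]
  change _ = inner ℝ (gradX f x y - hessXY g x y v) w.fst
    + inner ℝ (gradY f x y - hessYY g x y v) w.snd
  rw [inner_sub_left, inner_sub_left]
  ring

/-! ### The lower-level problem and the linear system -/

/-- `v*(x, y)`, the solution of the linear system `∇_y∇_y g(x, y) v = ∇_y f(x, y)`, unique when
`∇_y∇_y g(x, y)` is invertible. -/
def vStar (f g : Joint dx dy → ℝ) (x : Vec dx) (y : Vec dy) : Vec dy :=
  Classical.epsilon fun v => hessYY g x y v = gradY f x y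

namespace Regular

variable {f g : Joint dx dy → ℝ} {μ : ℝ} {Lf0 Lf1 Lg1 Lg2 : ℝ≥0}

theorem hasGradientAt_gradY (hR : Regular f g μ Lf0 Lf1 Lg1 Lg2) (x : Vec dx) (y : Vec dy) :
    HasGradientAt (fun y' => g (pt x y')) (gradY g x y) y := by
  have hd := hR.contDiff_g.differentiable two_ne_zero
  rw [gradY_eq hd]
  exact hasGradientAt_right (hd _)

theorem norm_gradY_f_le (hR : Regular f g μ Lf0 Lf1 Lg1 Lg2) (x : Vec dx) (y : Vec dy) :
    ‖gradY f x y‖ ≤ Lf0 := by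
  rw [gradY_eq (hR.contDiff_f.differentiable two_ne_zero)]
  refine (norm_snd_le _).trans ?_
  rw [← (InnerProductSpace.toDual ℝ (Joint dx dy)).norm_map, toDual_gradient]
  exact norm_fderiv_le_of_lipschitz ℝ hR.lip_f

theorem norm_gradY_f_sub_le (hR : Regular f g μ Lf0 Lf1 Lg1 Lg2) (x x' : Vec dx) (y y' : Vec dy) :
    ‖gradY f x y - gradY f x' y'‖ ≤ Lf1 * ‖pt x y - pt x' y'‖ := by
  have hd := hR.contDiff_f.differentiable two_ne_zero
  rw [gradY_eq hd, gradY_eq hd, ← WithLp.sub_snd]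
  exact (norm_snd_le _).trans (hR.lip_grad_f.norm_sub_le _ _)

theorem norm_gradX_f_sub_le (hR : Regular f g μ Lf0 Lf1 Lg1 Lg2) (x x' : Vec dx) (y y' : Vec dy) :
    ‖gradX f x y - gradX f x' y'‖ ≤ Lf1 * ‖pt x y - pt x' y'‖ := by
  have hd := hR.contDiff_f.differentiable two_ne_zero
  rw [gradX_eq hd, gradX_eq hd, ← WithLp.sub_fst]
  exact (norm_fst_le _).trans (hR.lip_grad_f.norm_sub_le _ _)

theorem norm_gradY_sub_le (hR : Regular f g μ Lf0 Lf1 Lg1 Lg2) (x x' : Vec dx) (y y' : Vec dy) :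
    ‖gradY g x y - gradY g x' y'‖ ≤ Lg1 * ‖pt x y - pt x' y'‖ := by
  have hd := hR.contDiff_g.differentiable two_ne_zero
  rw [gradY_eq hd, gradY_eq hd, ← WithLp.sub_snd]
  exact (norm_snd_le _).trans (hR.lip_grad_g.norm_sub_le _ _)

theorem norm_gradY_sub_le_right (hR : Regular f g μ Lf0 Lf1 Lg1 Lg2) (x : Vec dx) (y y' : Vec dy) :
    ‖gradY g x y - gradY g x y'‖ ≤ Lg1 * ‖y - y'‖ := by
  rw [← norm_pt_sub_right x y y']
  exact hR.norm_gradY_sub_le x x y y'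

theorem norm_hessYY_le (hR : Regular f g μ Lf0 Lf1 Lg1 Lg2) (x : Vec dx) (y : Vec dy) :
    ‖hessYY g x y‖ ≤ Lg1 := by
  refine norm_fderiv_le_of_lipschitz ℝ (LipschitzWith.of_dist_le_mul fun y y' => ?_)
  rw [dist_eq_norm, dist_eq_norm]
  exact hR.norm_gradY_sub_le_right x y y'

theorem norm_hessXY_le (hR : Regular f g μ Lf0 Lf1 Lg1 Lg2) (x : Vec dx) (y : Vec dy) :
    ‖hessXY g x y‖ ≤ Lg1 := by
  rw [hessXY, LinearIsometryEquiv.norm_map]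
  refine norm_fderiv_le_of_lipschitz ℝ (LipschitzWith.of_dist_le_mul fun x x' => ?_)
  rw [dist_eq_norm, dist_eq_norm, ← norm_pt_sub_left x x' y]
  exact hR.norm_gradY_sub_le x x' y y

theorem norm_hessYY_apply_sub_le (hR : Regular f g μ Lf0 Lf1 Lg1 Lg2) (x x' : Vec dx)
    (y y' v : Vec dy) :
    ‖hessYY g x y v - hessYY g x' y' v‖ ≤ Lg2 * ‖pt x y - pt x' y'‖ * ‖v‖ :=
  ((hessYY g x y - hessYY g x' y').le_opNorm v).trans
    (mul_le_mul_of_nonneg_right (hR.lip_hessYY.norm_sub_le (pt x y) (pt x' y')) (norm_nonneg v))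

theorem norm_hessXY_apply_sub_le (hR : Regular f g μ Lf0 Lf1 Lg1 Lg2) (x x' : Vec dx)
    (y y' v : Vec dy) :
    ‖hessXY g x y v - hessXY g x' y' v‖ ≤ Lg2 * ‖pt x y - pt x' y'‖ * ‖v‖ :=
  ((hessXY g x y - hessXY g x' y').le_opNorm v).trans
    (mul_le_mul_of_nonneg_right (hR.lip_hessXY.norm_sub_le (pt x y) (pt x' y')) (norm_nonneg v))

theorem mul_norm_sq_le_inner_hessYY (hR : Regular f g μ Lf0 Lf1 Lg1 Lg2) (x : Vec dx)
    (y w : Vec dy) : μ * ‖w‖ ^ 2 ≤ inner ℝ (hessYY g x y w) w := by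
  have hd : DifferentiableAt ℝ (fun y' => gradY g x y') y :=
    (((contDiff_gradY hR.contDiff_g).comp (contDiff_pt_right x)).differentiable one_ne_zero) y
  have h1 : HasDerivAt (fun t : ℝ => y + t • w) w 0 := by
    simpa using ((hasDerivAt_id (0 : ℝ)).smul_const w).const_add y
  have h2 : HasDerivAt (fun t : ℝ => gradY g x (y + t • w)) (hessYY g x y w) 0 := by
    refine HasFDerivAt.comp_hasDerivAt (f := fun t : ℝ => y + t • w) 0 ?_ h1
    rw [zero_smul, add_zero]
    exact hd.hasFDerivAt
  have h3 := h2.tendsto_slope_zero_right.inner (𝕜 := ℝ) (tendsto_const_nhds (x := w))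
  refine ge_of_tendsto h3 ?_
  filter_upwards [self_mem_nhdsWithin] with t (ht : 0 < t)
  have h4 := strong_monotone (fun u => hR.hasGradientAt_gradY x u) (hR.strongConvex x) y (t • w)
  simp only [zero_add, zero_smul, add_zero]
  rw [norm_smul, Real.norm_eq_abs, abs_of_pos ht, inner_smul_right] at h4
  rw [real_inner_smul_left, inv_mul_eq_div, le_div_iff₀ ht]
  nlinarith

theorem mul_norm_le_hessYY (hR : Regular f g μ Lf0 Lf1 Lg1 Lg2) (x : Vec dx) (y w : Vec dy) :
    μ * ‖w‖ ≤ ‖hessYY g x y w‖ :=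
  mul_norm_le_of_inner (hR.mul_norm_sq_le_inner_hessYY x y w)

theorem hessYY_vStar (hR : Regular f g μ Lf0 Lf1 Lg1 Lg2) (hμ : 0 < μ) (x : Vec dx) (y : Vec dy) :
    hessYY g x y (vStar f g x y) = gradY f x y := by
  have hinj : Function.Injective (hessYY g x y : Vec dy →ₗ[ℝ] Vec dy) := by
    refine (injective_iff_map_eq_zero _).2 fun w hw => ?_
    have h1 := hR.mul_norm_le_hessYY x y w
    rw [show hessYY g x y w = 0 from hw, norm_zero] at h1
    exact norm_le_zero_iff.1 (nonpos_of_mul_nonpos_right h1 hμ)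
  exact Classical.epsilon_spec (LinearMap.injective_iff_surjective.1 hinj (gradY f x y))

theorem norm_vStar_le (hR : Regular f g μ Lf0 Lf1 Lg1 Lg2) (hμ : 0 < μ) (x : Vec dx) (y : Vec dy) :
    ‖vStar f g x y‖ ≤ Lf0 / μ := by
  rw [le_div_iff₀' hμ]
  refine (hR.mul_norm_le_hessYY x y _).trans ?_
  rw [hR.hessYY_vStar hμ]
  exact hR.norm_gradY_f_le x y

theorem yStar_le (hR : Regular f g μ Lf0 Lf1 Lg1 Lg2) (hμ : 0 < μ) (x : Vec dx) (y : Vec dy) :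
    g (pt x (yStar g x)) ≤ g (pt x y) :=
  Classical.epsilon_spec (p := fun y => ∀ y' : Vec dy, g (pt x y) ≤ g (pt x y'))
    (exists_minimizer hμ (fun u => hR.hasGradientAt_gradY x u) (hR.strongConvex x)) y

theorem gradY_yStar (hR : Regular f g μ Lf0 Lf1 Lg1 Lg2) (hμ : 0 < μ) (x : Vec dx) :
    gradY g x (yStar g x) = 0 :=
  gradient_eq_zero_of_forall_le (hR.hasGradientAt_gradY x _) (hR.yStar_le hμ x)

theorem norm_sub_yStar_le (hR : Regular f g μ Lf0 Lf1 Lg1 Lg2) (hμ : 0 < μ) (x : Vec dx)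
    (y : Vec dy) : ‖y - yStar g x‖ ≤ ‖gradY g x y‖ / μ := by
  rw [le_div_iff₀' hμ]
  have h1 := strong_monotone (fun u => hR.hasGradientAt_gradY x u) (hR.strongConvex x)
    (yStar g x) (y - yStar g x)
  rw [add_sub_cancel, hR.gradY_yStar hμ, sub_zero] at h1
  exact mul_norm_le_of_inner h1

theorem norm_yStar_sub_le (hR : Regular f g μ Lf0 Lf1 Lg1 Lg2) (hμ : 0 < μ) (x x' : Vec dx) :
    ‖yStar g x - yStar g x'‖ ≤ Lg1 / μ * ‖x - x'‖ := by
  refine (hR.norm_sub_yStar_le hμ x' _).trans ?_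
  rw [div_mul_eq_mul_div]
  gcongr
  have h1 := hR.norm_gradY_sub_le x' x (yStar g x) (yStar g x)
  rwa [hR.gradY_yStar hμ x, sub_zero, norm_pt_sub_left, norm_sub_rev] at h1

theorem norm_pt_yStar_sub_le (hR : Regular f g μ Lf0 Lf1 Lg1 Lg2) (hμ : 0 < μ) (x x' : Vec dx) :
    ‖pt x (yStar g x) - pt x' (yStar g x')‖ ≤ (1 + Lg1 / μ) * ‖x - x'‖ := by
  have h1 := norm_pt_sub_le x x' (yStar g x) (yStar g x')
  have h2 := hR.norm_yStar_sub_le hμ x x'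
  linarith

theorem hasGradientAt_linSys (hR : Regular f g μ Lf0 Lf1 Lg1 Lg2) (x : Vec dx) (y v : Vec dy) :
    HasGradientAt (linSys f g x y) (hessYY g x y v - gradY f x y) v := by
  have h1 : HasFDerivAt (fun v' : Vec dy => v') (ContinuousLinearMap.id ℝ (Vec dy)) v :=
    hasFDerivAt_id v
  have h2 := ((h1.inner ℝ (hessYY g x y).hasFDerivAt).const_mul (1 / 2)).sub
    (h1.inner ℝ (hasFDerivAt_const (gradY f x y) v))
  refine h2.congr_fderiv ?_
  ext w
  have h3 := inner_hessYY_comm hR.contDiff_g x y v w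
  have h4 := real_inner_comm w (hessYY g x y v)
  have h5 := real_inner_comm w (gradY f x y)
  simp [fderivInnerCLM_apply]
  linarith

theorem gradLinSys_eq (hR : Regular f g μ Lf0 Lf1 Lg1 Lg2) (x : Vec dx) (y v : Vec dy) :
    gradLinSys f g x y v = hessYY g x y v - gradY f x y :=
  (hR.hasGradientAt_linSys x y v).gradient

theorem hasGradientAt_gradLinSys (hR : Regular f g μ Lf0 Lf1 Lg1 Lg2) (x : Vec dx) (y v : Vec dy) :
    HasGradientAt (linSys f g x y) (gradLinSys f g x y v) v := by
  rw [hR.gradLinSys_eq]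
  exact hR.hasGradientAt_linSys x y v

theorem norm_gradLinSys_sub_le (hR : Regular f g μ Lf0 Lf1 Lg1 Lg2) (x : Vec dx)
    (y v v' : Vec dy) : ‖gradLinSys f g x y v - gradLinSys f g x y v'‖ ≤ Lg1 * ‖v - v'‖ := by
  rw [hR.gradLinSys_eq, hR.gradLinSys_eq, sub_sub_sub_cancel_right, ← map_sub]
  exact (hessYY g x y).le_of_opNorm_le (hR.norm_hessYY_le x y) _

theorem gradLinSys_vStar (hR : Regular f g μ Lf0 Lf1 Lg1 Lg2) (hμ : 0 < μ) (x : Vec dx)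
    (y : Vec dy) : gradLinSys f g x y (vStar f g x y) = 0 := by
  rw [hR.gradLinSys_eq, hR.hessYY_vStar hμ, sub_self]

theorem linSys_vStar_le (hR : Regular f g μ Lf0 Lf1 Lg1 Lg2) (hμ : 0 < μ) (x : Vec dx)
    (y v : Vec dy) : linSys f g x y (vStar f g x y) ≤ linSys f g x y v := by
  obtain ⟨w, rfl⟩ : ∃ w, v = vStar f g x y + w := ⟨v - vStar f g x y, by abel⟩
  have h1 := hR.mul_norm_sq_le_inner_hessYY x y w
  have h2 := inner_hessYY_comm hR.contDiff_g x y (vStar f g x y) w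
  have h3 := real_inner_comm w (hessYY g x y w)
  have h4 := real_inner_comm w (gradY f x y)
  have h5 : 0 ≤ μ * ‖w‖ ^ 2 := by positivity
  rw [hR.hessYY_vStar hμ] at h2
  simp only [linSys, map_add, inner_add_left, inner_add_right, hR.hessYY_vStar hμ]
  linarith

/-! ### Sensitivity of the hypergradient estimate -/

/-- Stability of the linear system: the distance of an approximate solution at `(x, y)` from `v'` is
controlled by the residuals and by the distance of the two base points. -/
theorem mul_norm_sub_le (hR : Regular f g μ Lf0 Lf1 Lg1 Lg2) (x x' : Vec dx) (y y' v v' : Vec dy) :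
    μ * ‖v - v'‖ ≤ ‖gradLinSys f g x y v - gradLinSys f g x' y' v'‖
      + (Lf1 + Lg2 * ‖v'‖) * ‖pt x y - pt x' y'‖ := by
  refine (hR.mul_norm_le_hessYY x y (v - v')).trans ?_
  have h1 : hessYY g x y (v - v') = (gradLinSys f g x y v - gradLinSys f g x' y' v')
      + (gradY f x y - gradY f x' y') - (hessYY g x y v' - hessYY g x' y' v') := by
    rw [hR.gradLinSys_eq, hR.gradLinSys_eq, map_sub]
    abel
  rw [h1]
  have h2 := hR.norm_gradY_f_sub_le x x' y y'
  have h3 := hR.norm_hessYY_apply_sub_le x x' y y' v'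
  refine (norm_sub_le _ _).trans ?_
  have h4 := norm_add_le (gradLinSys f g x y v - gradLinSys f g x' y' v')
    (gradY f x y - gradY f x' y')
  linarith

theorem norm_hyperGrad_sub_le (hR : Regular f g μ Lf0 Lf1 Lg1 Lg2) (x x' : Vec dx)
    (y y' v v' : Vec dy) :
    ‖hyperGrad f g x y v - hyperGrad f g x' y' v'‖
      ≤ (Lf1 + Lg2 * ‖v'‖) * ‖pt x y - pt x' y'‖ + Lg1 * ‖v - v'‖ := by
  have h1 : hyperGrad f g x y v - hyperGrad f g x' y' v' = (gradX f x y - gradX f x' y')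
      - hessXY g x y (v - v') - (hessXY g x y v' - hessXY g x' y' v') := by
    rw [hyperGrad, hyperGrad, map_sub]
    abel
  rw [h1]
  have h2 := hR.norm_gradX_f_sub_le x x' y y'
  have h3 := hR.norm_hessXY_apply_sub_le x x' y y' v'
  have h4 := (hessXY g x y).le_of_opNorm_le (hR.norm_hessXY_le x y) (v - v')
  refine (norm_sub_le _ _).trans ?_
  have h5 := norm_sub_le (gradX f x y - gradX f x' y') (hessXY g x y (v - v'))
  linarith

/-- If `(y, v)` nearly solves the two lower-level equations at `x`, measured against an exact
solution at `x'`, then the hypergradient estimates nearly agree. -/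
theorem norm_hyperGrad_sub_vStar_le (hR : Regular f g μ Lf0 Lf1 Lg1 Lg2) (hμ : 0 < μ)
    (x x' : Vec dx) (y y' v : Vec dy) {d r : ℝ} (hd : ‖pt x y - pt x' y'‖ ≤ d)
    (hr : ‖gradLinSys f g x y v‖ ≤ r) :
    ‖hyperGrad f g x y v - hyperGrad f g x' y' (vStar f g x' y')‖
      ≤ (Lf1 + Lg2 * (Lf0 / μ)) * d + Lg1 * ((r + (Lf1 + Lg2 * (Lf0 / μ)) * d) / μ) := by
  have h0 := hR.norm_vStar_le hμ x' y'
  have h1 := hR.mul_norm_sub_le x x' y y' v (vStar f g x' y')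
  rw [hR.gradLinSys_vStar hμ, sub_zero] at h1
  have h2 : (Lf1 + Lg2 * ‖vStar f g x' y'‖) * ‖pt x y - pt x' y'‖
      ≤ (Lf1 + Lg2 * (Lf0 / μ)) * d := by gcongr
  refine (hR.norm_hyperGrad_sub_le x x' y y' v (vStar f g x' y')).trans ?_
  gcongr
  rw [le_div_iff₀' hμ]
  linarith

/-! ### The outer objective -/

/-- The hypergradient formula. With `v = v*(x, y*(x))` fixed, `Φ(x') = ψ(x', y*(x'))` for
`ψ = f - ⟪v, ∇_y g⟫`, because `∇_y g(x', y*(x')) = 0`; and the `y`-gradient of `ψ` vanishes at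
`(x, y*(x))`, so that Lipschitz continuity of `y*` is enough and its derivative is not needed. -/
theorem hasGradientAt_Phi (hR : Regular f g μ Lf0 Lf1 Lg1 Lg2) (hμ : 0 < μ) (x : Vec dx) :
    HasGradientAt (Phi f g) (hyperGrad f g x (yStar g x) (vStar f g x (yStar g x))) x := by
  have h1 := hasGradientAt_lagrangian hR.contDiff_f hR.contDiff_g x (yStar g x)
    (vStar f g x (yStar g x))
  rw [hR.hessYY_vStar hμ, sub_self, hasGradientAt_iff_isLittleO] at h1
  have hO : (fun x' => pt x' (yStar g x') - pt x (yStar g x)) =O[nhds x] fun x' => x' - x :=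
    Asymptotics.IsBigO.of_bound _
      (Filter.Eventually.of_forall fun x' => hR.norm_pt_yStar_sub_le hμ x' x)
  have ht : Filter.Tendsto (fun x' => pt x' (yStar g x')) (nhds x) (nhds (pt x (yStar g x))) := by
    refine tendsto_sub_nhds_zero_iff.1 (hO.trans_tendsto ?_)
    exact Continuous.tendsto' (by fun_prop) _ _ (sub_self x)
  rw [hasGradientAt_iff_isLittleO]
  refine ((h1.comp_tendsto ht).trans_isBigO hO).congr_left fun x' => ?_
  simp only [Function.comp_apply, inner_joint, WithLp.sub_fst]
  simp [Phi, hR.gradY_yStar hμ]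

theorem gradient_Phi (hR : Regular f g μ Lf0 Lf1 Lg1 Lg2) (hμ : 0 < μ) (x : Vec dx) :
    ∇ (Phi f g) x = hyperGrad f g x (yStar g x) (vStar f g x (yStar g x)) :=
  (hR.hasGradientAt_Phi hμ x).gradient

theorem differentiable_Phi (hR : Regular f g μ Lf0 Lf1 Lg1 Lg2) (hμ : 0 < μ) :
    Differentiable ℝ (Phi f g) := fun x => (hR.hasGradientAt_Phi hμ x).differentiableAt

end Regular

/-- A Lipschitz constant of `∇Φ`. -/
def lipPhi (μ : ℝ) (Lf0 Lf1 Lg1 Lg2 : ℝ≥0) : ℝ :=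
  ((Lf1 + Lg2 * (Lf0 / μ)) + Lg1 * ((Lf1 + Lg2 * (Lf0 / μ)) / μ)) * (1 + Lg1 / μ)

/-- The factor by which tolerances on `‖∇_y g‖` and `‖∇_v R‖` are amplified in the error of the
hypergradient estimate. -/
def errConst (μ : ℝ) (Lf0 Lf1 Lg1 Lg2 : ℝ≥0) : ℝ :=
  (Lf1 + Lg2 * (Lf0 / μ)) / μ + Lg1 * ((1 + (Lf1 + Lg2 * (Lf0 / μ)) / μ) / μ)

namespace Regular

variable {f g : Joint dx dy → ℝ} {μ : ℝ} {Lf0 Lf1 Lg1 Lg2 : ℝ≥0}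

theorem norm_gradient_Phi_sub_le (hR : Regular f g μ Lf0 Lf1 Lg1 Lg2) (hμ : 0 < μ) (x x' : Vec dx) :
    ‖∇ (Phi f g) x - ∇ (Phi f g) x'‖ ≤ lipPhi μ Lf0 Lf1 Lg1 Lg2 * ‖x - x'‖ := by
  rw [hR.gradient_Phi hμ, hR.gradient_Phi hμ]
  refine (hR.norm_hyperGrad_sub_vStar_le hμ x x' _ _ _ (hR.norm_pt_yStar_sub_le hμ x x')
    (r := 0) (by rw [hR.gradLinSys_vStar hμ, norm_zero])).trans_eq ?_
  rw [lipPhi]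
  ring

/-- The error of the hypergradient estimate when both sub-loops stop at squared tolerance `e`. -/
theorem norm_hyperGrad_sub_gradient_Phi_sq_le (hR : Regular f g μ Lf0 Lf1 Lg1 Lg2) (hμ : 0 < μ)
    (x : Vec dx) (y v : Vec dy) {e : ℝ} (he : 0 ≤ e) (hy : ‖gradY g x y‖ ^ 2 ≤ e)
    (hv : ‖gradLinSys f g x y v‖ ^ 2 ≤ e) :
    ‖hyperGrad f g x y v - ∇ (Phi f g) x‖ ^ 2 ≤ errConst μ Lf0 Lf1 Lg1 Lg2 ^ 2 * e := by
  have hd : ‖pt x y - pt x (yStar g x)‖ ≤ √e / μ := by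
    rw [norm_pt_sub_right]
    refine (hR.norm_sub_yStar_le hμ x y).trans ?_
    gcongr
    exact Real.le_sqrt_of_sq_le hy
  have h1 := hR.norm_hyperGrad_sub_vStar_le hμ x x y (yStar g x) v hd (Real.le_sqrt_of_sq_le hv)
  rw [hR.gradient_Phi hμ]
  calc _ ≤ (errConst μ Lf0 Lf1 Lg1 Lg2 * √e) ^ 2 := by
        gcongr
        refine h1.trans_eq ?_
        rw [errConst]
        ring
    _ = _ := by rw [mul_pow, Real.sq_sqrt he]

end Regular

/-! ### Executions of the algorithm -/

namespace Regular

variable {f g : Joint dx dy → ℝ} {μ : ℝ} {Lf0 Lf1 Lg1 Lg2 : ℝ≥0}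

/-- Both sub-loops terminate from every starting point, so that an execution can be built by
recursion on the outer iteration. -/
theorem nonempty_DTFBO (hR : Regular f g μ Lf0 Lf1 Lg1 Lg2) (hμ : 0 < μ) {β0 γ0 : ℝ}
    (hβ : 0 < β0) (hγ : 0 < γ0) (x0 : Vec dx) (y0 v0 : Vec dy) (α0 : ℝ) {T : ℕ} (hT : 0 < T) :
    Nonempty (DTFBO f g x0 y0 v0 α0 β0 γ0 T) := by
  have he : (0 : ℝ) < 1 / T := by positivity
  have hP : ∀ (x : Vec dx) (y : Vec dy), ∃ N, ExitsAt (gradY g x) β0 y (1 / (T : ℝ)) N :=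
    fun x y => exists_exitsAt Lg1.coe_nonneg (hR.hasGradientAt_gradY x)
      (hR.norm_gradY_sub_le_right x) (hR.yStar_le hμ x) hβ y he
  have hQ : ∀ (x : Vec dx) (y v : Vec dy),
      ∃ N, ExitsAt (gradLinSys f g x y) γ0 v (1 / (T : ℝ)) N :=
    fun x y v => exists_exitsAt Lg1.coe_nonneg (hR.hasGradientAt_gradLinSys x y)
      (hR.norm_gradLinSys_sub_le x y) (hR.linSys_vStar_le hμ x y) hγ v he
  choose P hP using hP
  choose Q hQ using hQ
  let yNext (x : Vec dx) (y : Vec dy) : Vec dy := (adaIter (gradY g x) β0 y (P x y)).1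
  let vNext (x : Vec dx) (y v : Vec dy) : Vec dy :=
    (adaIter (gradLinSys f g x y) γ0 v (Q x y v)).1
  let aNext (a : ℝ) (h : Vec dx) : ℝ := √(a ^ 2 + ‖h‖ ^ 2)
  let S : ℕ → Vec dx × Vec dy × Vec dy × ℝ := fun t =>
    Nat.rec (x0, y0, v0, α0) (fun _ s =>
      let y' := yNext s.1 s.2.1
      let v' := vNext s.1 y' s.2.2.1
      let h := hyperGrad f g s.1 y' v'
      let a' := aNext s.2.2.2 h
      (s.1 - (1 / a') • h, y', v', a')) t
  exact ⟨{
    x := fun t => (S t).1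
    y := fun t => (S t).2.1
    v := fun t => (S t).2.2.1
    α := fun t => (S t).2.2.2
    P := fun t => P (S t).1 (S t).2.1
    Q := fun t => Q (S t).1 (S (t + 1)).2.1 (S t).2.2.1
    x_zero := rfl
    y_zero := rfl
    v_zero := rfl
    α_zero := rfl
    y_exit := fun t _ => hP _ _
    y_succ := fun t _ => rfl
    v_exit := fun t _ => hQ _ _ _
    v_succ := fun t _ => rfl
    α_succ := fun t _ => rfl
    x_succ := fun t _ => rfl }⟩

end Regular

/-- A bound, uniform over runs, on the sum of the squared hypergradient norms. -/
def sumBound (μ : ℝ) (Lf0 Lf1 Lg1 Lg2 : ℝ≥0) (α0 Δ : ℝ) : ℝ :=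
  accBound (lipPhi μ Lf0 Lf1 Lg1 Lg2) α0 |Δ| (errConst μ Lf0 Lf1 Lg1 Lg2 ^ 2) ^ 2 / 2

/-- A bound on the number of iterations of a sub-loop with tolerance `1 / T`, divided by `T`, for
initial accumulator `b0` and initial distance `D` to the minimizer. -/
def loopBound (L : ℝ) (b0 D : ℝ) : ℝ := accBound L b0 (L / 2 * D ^ 2) 0 ^ 2 / 2

namespace DTFBO

variable {f g : Joint dx dy → ℝ} {μ : ℝ} {Lf0 Lf1 Lg1 Lg2 : ℝ≥0} {x0 : Vec dx} {y0 v0 : Vec dy}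
  {α0 β0 γ0 : ℝ} {T : ℕ}

theorem norm_gradY_sq_le (r : DTFBO f g x0 y0 v0 α0 β0 γ0 T) {t : ℕ} (ht : t < T) :
    ‖gradY g (r.x t) (r.y (t + 1))‖ ^ 2 ≤ 1 / (T : ℝ) := by
  rw [r.y_succ t ht]
  exact (r.y_exit t ht).1

theorem norm_gradLinSys_sq_le (r : DTFBO f g x0 y0 v0 α0 β0 γ0 T) {t : ℕ} (ht : t < T) :
    ‖gradLinSys f g (r.x t) (r.y (t + 1)) (r.v (t + 1))‖ ^ 2 ≤ 1 / (T : ℝ) := by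
  rw [r.v_succ t ht]
  exact (r.v_exit t ht).1

theorem sum_norm_gradient_Phi_sq_le (r : DTFBO f g x0 y0 v0 α0 β0 γ0 T)
    (hR : Regular f g μ Lf0 Lf1 Lg1 Lg2) (hμ : 0 < μ) (hα : 0 < α0) {m Δ : ℝ}
    (hm : ∀ x, m ≤ Phi f g x) (hΔ : Phi f g x0 - m ≤ Δ) :
    ∑ t ∈ Finset.range T, ‖∇ (Phi f g) (r.x t)‖ ^ 2 ≤ sumBound μ Lf0 Lf1 Lg1 Lg2 α0 Δ := by
  have hG : ∀ x, HasGradientAt (Phi f g) (∇ (Phi f g) x) x :=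
    fun x => (hR.differentiable_Phi hμ x).hasGradientAt
  have hL : 0 ≤ lipPhi μ Lf0 Lf1 Lg1 Lg2 := by
    unfold lipPhi
    positivity
  -- Each squared error is at most `errConst ^ 2 / T`, so that `T` of them sum to a constant.
  have hS : ∑ t ∈ Finset.range T, ‖hyperGrad f g (r.x t) (r.y (t + 1)) (r.v (t + 1))
      - ∇ (Phi f g) (r.x t)‖ ^ 2 ≤ errConst μ Lf0 Lf1 Lg1 Lg2 ^ 2 := by
    rcases T.eq_zero_or_pos with rfl | hT
    · simp only [Finset.range_zero, Finset.sum_empty]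
      positivity
    · have hT' : (0 : ℝ) < T := by exact_mod_cast hT
      refine (Finset.sum_le_card_nsmul _ _ (errConst μ Lf0 Lf1 Lg1 Lg2 ^ 2 * (1 / T))
        fun t ht => ?_).trans_eq ?_
      · have ht' := Finset.mem_range.1 ht
        exact hR.norm_hyperGrad_sub_gradient_Phi_sq_le hμ _ _ _ (by positivity)
          (r.norm_gradY_sq_le ht') (r.norm_gradLinSys_sq_le ht')
      · rw [Finset.card_range, nsmul_eq_mul]
        field_simp
  have h1 := (acc_le_and_sum_sq_le hL hG (hR.norm_gradient_Phi_sub_le hμ) hm (x := r.x)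
    (h := fun t => hyperGrad f g (r.x t) (r.y (t + 1)) (r.v (t + 1))) (a := r.α) (T := T)
    (D := |Δ|) (by rwa [r.α_zero]) r.α_succ r.x_succ
    (by rw [r.x_zero]; exact hΔ.trans (le_abs_self Δ)) hS).2
  rwa [r.α_zero] at h1

/-- A step has length at most `1`, as the accumulator dominates the current direction. -/
theorem norm_x_succ_sub_le (r : DTFBO f g x0 y0 v0 α0 β0 γ0 T) {t : ℕ} (ht : t < T) :
    ‖r.x (t + 1) - r.x t‖ ≤ 1 := by
  have h1 : ‖hyperGrad f g (r.x t) (r.y (t + 1)) (r.v (t + 1))‖ ≤ r.α (t + 1) := by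
    rw [r.α_succ t ht]
    exact Real.le_sqrt_of_sq_le (by nlinarith [sq_nonneg (r.α t)])
  rw [r.x_succ t ht, sub_sub_cancel_left, norm_neg, norm_smul, norm_div, norm_one, Real.norm_eq_abs,
    abs_of_nonneg ((norm_nonneg _).trans h1), one_div_mul_eq_div]
  exact div_le_one_of_le₀ h1 ((norm_nonneg _).trans h1)

theorem norm_y_sub_yStar_le (r : DTFBO f g x0 y0 v0 α0 β0 γ0 T)
    (hR : Regular f g μ Lf0 Lf1 Lg1 Lg2) (hμ : 0 < μ) {Dy : ℝ} (hD : ‖y0 - yStar g x0‖ ≤ Dy)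
    {t : ℕ} (ht : t < T) : ‖r.y t - yStar g (r.x t)‖ ≤ |Dy| + 1 / μ + Lg1 / μ := by
  have h0 := abs_nonneg Dy
  have h1 : (0 : ℝ) ≤ 1 / μ := by positivity
  have h2 : (0 : ℝ) ≤ Lg1 / μ := by positivity
  cases t with
  | zero =>
    rw [r.y_zero, r.x_zero]
    linarith [le_abs_self Dy]
  | succ t =>
    have ht' : t < T := by omega
    have h3 : ‖gradY g (r.x t) (r.y (t + 1))‖ ≤ 1 := by
      refine (sq_le_one_iff₀ (norm_nonneg _)).1 ((r.norm_gradY_sq_le ht').trans ?_)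
      rw [one_div]
      exact Nat.cast_inv_le_one T
    have h4 : ‖r.y (t + 1) - yStar g (r.x t)‖ ≤ 1 / μ :=
      (hR.norm_sub_yStar_le hμ _ _).trans (by gcongr)
    have h5 : ‖yStar g (r.x t) - yStar g (r.x (t + 1))‖ ≤ Lg1 / μ := by
      refine (hR.norm_yStar_sub_le hμ _ _).trans (mul_le_of_le_one_right h2 ?_)
      rw [norm_sub_rev]
      exact r.norm_x_succ_sub_le ht'
    linarith [norm_sub_le_norm_sub_add_norm_sub (r.y (t + 1)) (yStar g (r.x t))
      (yStar g (r.x (t + 1)))]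

theorem norm_v_sub_vStar_le (r : DTFBO f g x0 y0 v0 α0 β0 γ0 T)
    (hR : Regular f g μ Lf0 Lf1 Lg1 Lg2) (hμ : 0 < μ) {Dv : ℝ} (hD : ‖v0‖ ≤ Dv)
    {t : ℕ} (ht : t < T) :
    ‖r.v t - vStar f g (r.x t) (r.y (t + 1))‖ ≤ |Dv| + 1 / μ + 2 * (Lf0 / μ) := by
  have h0 := abs_nonneg Dv
  have h1 : (0 : ℝ) ≤ 1 / μ := by positivity
  have h2 := hR.norm_vStar_le hμ (r.x t) (r.y (t + 1))
  have h3 : (0 : ℝ) ≤ Lf0 / μ := by positivity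
  refine (norm_sub_le _ _).trans ?_
  suffices h : ‖r.v t‖ ≤ |Dv| + 1 / μ + Lf0 / μ by linarith
  cases t with
  | zero =>
    rw [r.v_zero]
    linarith [le_abs_self Dv]
  | succ t =>
    have ht' : t < T := by omega
    have h4 : ‖gradLinSys f g (r.x t) (r.y (t + 1)) (r.v (t + 1))‖ ≤ 1 := by
      refine (sq_le_one_iff₀ (norm_nonneg _)).1 ((r.norm_gradLinSys_sq_le ht').trans ?_)
      rw [one_div]
      exact Nat.cast_inv_le_one T
    have h5 : ‖r.v (t + 1)‖ ≤ (1 + Lf0) / μ := by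
      rw [le_div_iff₀' hμ]
      refine (hR.mul_norm_le_hessYY (r.x t) (r.y (t + 1)) _).trans ?_
      have h6 := hR.gradLinSys_eq (r.x t) (r.y (t + 1)) (r.v (t + 1))
      rw [eq_sub_iff_add_eq] at h6
      rw [← h6]
      exact (norm_add_le _ _).trans (add_le_add h4 (hR.norm_gradY_f_le _ _))
    rw [add_div] at h5
    linarith

theorem P_le (r : DTFBO f g x0 y0 v0 α0 β0 γ0 T) (hR : Regular f g μ Lf0 Lf1 Lg1 Lg2) (hμ : 0 < μ)
    (hβ : 0 < β0) {Dy : ℝ} (hD : ‖y0 - yStar g x0‖ ≤ Dy) {t : ℕ} (ht : t < T) :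
    (r.P t : ℝ) ≤ loopBound Lg1 β0 (|Dy| + 1 / μ + Lg1 / μ) * T := by
  have h1 := length_mul_le Lg1.coe_nonneg (hR.hasGradientAt_gradY (r.x t))
    (hR.norm_gradY_sub_le_right (r.x t)) (hR.yStar_le hμ (r.x t)) hβ
    (r.norm_y_sub_yStar_le hR hμ hD ht) (r.y_exit t ht).2
  have hT : (0 : ℝ) < T := by exact_mod_cast (Nat.zero_le t).trans_lt ht
  rwa [mul_one_div, div_le_iff₀ hT] at h1

theorem Q_le (r : DTFBO f g x0 y0 v0 α0 β0 γ0 T) (hR : Regular f g μ Lf0 Lf1 Lg1 Lg2) (hμ : 0 < μ)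
    (hγ : 0 < γ0) {Dv : ℝ} (hD : ‖v0‖ ≤ Dv) {t : ℕ} (ht : t < T) :
    (r.Q t : ℝ) ≤ loopBound Lg1 γ0 (|Dv| + 1 / μ + 2 * (Lf0 / μ)) * T := by
  have h1 := length_mul_le Lg1.coe_nonneg (hR.hasGradientAt_gradLinSys (r.x t) (r.y (t + 1)))
    (hR.norm_gradLinSys_sub_le (r.x t) (r.y (t + 1))) (hR.linSys_vStar_le hμ _ _) hγ
    (r.norm_v_sub_vStar_le hR hμ hD ht) (r.v_exit t ht).2
  have hT : (0 : ℝ) < T := by exact_mod_cast (Nat.zero_le t).trans_lt ht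
  rwa [mul_one_div, div_le_iff₀ hT] at h1

theorem gradientCount_le (r : DTFBO f g x0 y0 v0 α0 β0 γ0 T) {p q : ℝ}
    (hP : ∀ t < T, (r.P t : ℝ) ≤ p * T) (hQ : ∀ t < T, (r.Q t : ℝ) ≤ q * T) :
    (r.gradientCount : ℝ) ≤ (p + 2 * q + 5) * T ^ 2 := by
  rw [gradientCount]
  push_cast
  refine (Finset.sum_le_card_nsmul _ _ ((p + 2 * q + 5) * T) fun t ht => ?_).trans_eq ?_
  · have ht' := Finset.mem_range.1 ht
    have h1 := hP t ht'
    have h2 := hQ t ht'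
    have h3 : (1 : ℝ) ≤ T := by exact_mod_cast (Nat.zero_le t).trans_lt ht'
    nlinarith
  · rw [Finset.card_range, nsmul_eq_mul]
    ring

end DTFBO

end Bilevel
end

theorem mainTheorem2 (μ : ℝ) (hμ : 0 < μ) (Lf0 Lf1 Lg1 Lg2 : ℝ≥0)
    (α0 : ℝ) (hα0 : 0 < α0) (Δ : ℝ) :
    ∃ C₀ : ℝ, 0 < C₀ ∧
      ∀ β0 γ0 Dy Dv : ℝ, 0 < β0 → 0 < γ0 →
      ∃ C₁ : ℝ, 0 < C₁ ∧
        ∀ (dx dy : ℕ) (f g : Bilevel.Joint dx dy → ℝ) (m : ℝ)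
          (x0 : Bilevel.Vec dx) (y0 v0 : Bilevel.Vec dy),
          Bilevel.Regular f g μ Lf0 Lf1 Lg1 Lg2 →
          (∀ x, m ≤ Bilevel.Phi f g x) →
          Bilevel.Phi f g x0 - m ≤ Δ →
          ‖y0 - Bilevel.yStar g x0‖ ≤ Dy →
          ‖v0‖ ≤ Dv →
          Differentiable ℝ (Bilevel.Phi f g) ∧
          ∀ ε : ℝ, 0 < ε → ε < 1 →
            -- every `T ≥ C₀ / ε` outer iterations yield an `ε`-accurate stationary point
            (∀ T : ℕ, C₀ / ε ≤ T →
              Nonempty (Bilevel.DTFBO f g x0 y0 v0 α0 β0 γ0 T) ∧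
              ∀ r : Bilevel.DTFBO f g x0 y0 v0 α0 β0 γ0 T,
                (1 / (T : ℝ)) * ∑ t ∈ Finset.range T, ‖∇ (Bilevel.Phi f g) (r.x t)‖ ^ 2 ≤ ε ∧
                ∃ t < T, Bilevel.IsAccurate (Bilevel.Phi f g) ε (r.x t)) ∧
            -- complexity for the least such `T`
            (∀ T : ℕ, T = ⌈C₀ / ε⌉₊ →
              (T : ℝ) ≤ C₁ / ε ∧
              ∀ r : Bilevel.DTFBO f g x0 y0 v0 α0 β0 γ0 T,
                (∀ t < T, (r.P t : ℝ) ≤ C₁ / ε ∧ (r.Q t : ℝ) ≤ C₁ / ε) ∧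
                (r.gradientCount : ℝ) ≤ C₁ / ε ^ 2) := by
  obtain ⟨C₀, hC₀⟩ : ∃ C, C = Bilevel.sumBound μ Lf0 Lf1 Lg1 Lg2 α0 Δ := ⟨_, rfl⟩
  have hC₀pos : 0 < C₀ := by
    have h1 : 0 ≤ Bilevel.lipPhi μ Lf0 Lf1 Lg1 Lg2 := by
      unfold Bilevel.lipPhi
      positivity
    have h2 := Bilevel.accBound_pos h1 hα0 (abs_nonneg Δ)
      (sq_nonneg (Bilevel.errConst μ Lf0 Lf1 Lg1 Lg2))
    rw [hC₀, Bilevel.sumBound]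
    positivity
  refine ⟨C₀, hC₀pos, fun β0 γ0 Dy Dv hβ hγ => ?_⟩
  obtain ⟨p, hp⟩ : ∃ p, p = Bilevel.loopBound Lg1 β0 (|Dy| + 1 / μ + Lg1 / μ) := ⟨_, rfl⟩
  obtain ⟨q, hq⟩ : ∃ q, q = Bilevel.loopBound Lg1 γ0 (|Dv| + 1 / μ + 2 * (Lf0 / μ)) := ⟨_, rfl⟩
  have hp0 : 0 ≤ p := by
    rw [hp, Bilevel.loopBound]
    positivity
  have hq0 : 0 ≤ q := by
    rw [hq, Bilevel.loopBound]
    positivity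
  have hC₁ : ∀ c, c ≤ p + 2 * q + 5 →
      c * (C₀ + 1) ≤ (p + 2 * q + 5) * (C₀ + 1) ^ 2 := fun c hc => by
    nlinarith [mul_nonneg (sub_nonneg.2 hc) (by linarith : 0 ≤ C₀ + 1),
      mul_pos (mul_pos (by linarith : 0 < p + 2 * q + 5) (by linarith : 0 < C₀ + 1)) hC₀pos]
  -- `T ≤ (C₀ + 1) / ε`, and all quantities are at most `p + 2 q + 5` times `T` or `T ^ 2`.
  refine ⟨(p + 2 * q + 5) * (C₀ + 1) ^ 2, by positivity, ?_⟩
  intro dx dy f g m x0 y0 v0 hR hm hΔ hDy hDv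
  refine ⟨hR.differentiable_Phi hμ, fun ε hε hε1 => ⟨fun T hT => ?_, fun T hT => ?_⟩⟩
  · have hTpos : (0 : ℝ) < T := (by positivity : (0 : ℝ) < C₀ / ε).trans_le hT
    refine ⟨hR.nonempty_DTFBO hμ hβ hγ x0 y0 v0 α0 (by exact_mod_cast hTpos), fun r => ?_⟩
    have h1 := r.sum_norm_gradient_Phi_sq_le hR hμ hα0 hm hΔ
    rw [← hC₀] at h1
    rw [div_le_iff₀ hε] at hT
    refine ⟨?_, ?_⟩
    · rw [one_div_mul_eq_div, div_le_iff₀ hTpos]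
      linarith
    · by_contra! hcon
      have h2 : ∀ t ∈ Finset.range T, ε < ‖∇ (Bilevel.Phi f g) (r.x t)‖ ^ 2 := fun t ht =>
        not_le.1 fun hle => hcon t (Finset.mem_range.1 ht) ⟨hR.differentiable_Phi hμ _, hle⟩
      have h3 := Finset.sum_lt_sum_of_nonempty
        (Finset.nonempty_range_iff.2 (by rintro rfl; simp at hTpos)) h2
      rw [Finset.sum_const, Finset.card_range, nsmul_eq_mul] at h3
      linarith
  · have hTle : (T : ℝ) ≤ (C₀ + 1) / ε := by
      have h1 := (Nat.ceil_lt_add_one (by positivity : 0 ≤ C₀ / ε)).le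
      have h2 : 1 ≤ 1 / ε := one_le_one_div hε hε1.le
      rw [hT, add_div]
      linarith
    have hmul : ∀ c, 0 ≤ c → c ≤ p + 2 * q + 5 →
        c * T ≤ (p + 2 * q + 5) * (C₀ + 1) ^ 2 / ε := fun c hc hc' =>
      calc c * T ≤ c * ((C₀ + 1) / ε) := by gcongr
        _ = c * (C₀ + 1) / ε := (mul_div_assoc _ _ _).symm
        _ ≤ _ := by
          gcongr ?_ / ε
          exact hC₁ c hc'
    refine ⟨?_, fun r => ?_⟩
    · simpa using hmul 1 zero_le_one (by linarith)
    · have hP : ∀ t < T, (r.P t : ℝ) ≤ p * T := fun t ht => by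
        rw [hp]
        exact r.P_le hR hμ hβ hDy ht
      have hQ : ∀ t < T, (r.Q t : ℝ) ≤ q * T := fun t ht => by
        rw [hq]
        exact r.Q_le hR hμ hγ hDv ht
      refine ⟨fun t ht => ⟨(hP t ht).trans (hmul p hp0 (by linarith)),
        (hQ t ht).trans (hmul q hq0 (by linarith))⟩, (r.gradientCount_le hP hQ).trans ?_⟩
      rw [mul_div_assoc, ← div_pow]
      gcongr
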